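/- Let $K$ be a field of prime characteristic $p$, and let $A_1=K\langle x,y\rangle/(xy-yx-1)$ be the first Weyl algebra over $K$, with $K$-basis $\{y^ix^j : i,j\in\mathbb N\}$, $\mathbb N=\{0,1,2,\dots\}$. Let $k_0\in K$ with $k_0\neq 0$, let $\alpha$ be the $K$-algebra endomorphism of $A_1$ with $\alpha(x)=x$ and $\alpha(y)=k_0+y$, and let $A_1^k$, $k=(k_0,0,0,\dots)$, be the hom-associative Weyl algebra, i.e. the $K$-vector space $A_1$ with the product $a*b:=\alpha(a\cdot b)$. A derivation of $A_1^k$ is a $K$-linear map $\delta$ with $\delta(a*b)=\delta(a)*b+a*\delta(b)$ for all $a,b$; the set of these is $\operatorname{Der}_K(A_1^k)$. Let $E_x,E_y\in\operatorname{Der}_K(A_1)$ be the derivations of the associative algebra $A_1$ given by $E_x(x)=y^{p-1}$, $E_x(y)=E_y(x)=0$, $E_y(y)=x^{p-1}$, and let $\operatorname{ad}_q(a)=q\cdot a-a\cdot q$. A $K$-linear map $\delta\colon A_1\to A_1$ belongs to $\operatorname{Der}_K(A_1^k)$ if and only if $$\delta=uE_x+vE_y+\operatorname{ad}_q$$ (products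 taken in $A_1$) for some $u=\sum_{i,j}u_{ij}y^ix^j\in K[x^p,y^p]$, $v=\sum_{i,j}v_{ij}y^ix^j\in K[x^p,y^p]$ and $q=\sum_{i,j}q_{ij}y^ix^j\in A_1$ (finite sums, $u_{ij},v_{ij},q_{ij}\in K$) satisfying, for all $j,l\in\mathbb N$ and all $m\in\mathbb N$ with $m>0$, $$\sum_{i\ge l+1}\binom{i}{l}v_{ij}k_0^{i}=\sum_{i\ge l+1}\binom{i}{l}u_{ij}k_0^{i}=\sum_{i\ge l+1}\binom{i}{l}\,j\,q_{ij}k_0^{i}=0,$$ $$\sum_{i\ge m+1}\binom{i}{m}\,m\,q_{ij}k_0^{i}=\sum_{i=\max(0,\,m-p+1)}^{m-1}\binom{p-1}{m-1-i}u_{ij}k_0^{i+p}.$$ -/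

import Mathlib

noncomputable section

namespace HomWeyl

/-! ### Derivations of non-associative algebras -/

/-- `Der R A`: the set of `R`-linear derivations of a (not necessarily associative or unital)
`R`-algebra `A`. -/
def Der (R A : Type*) [CommRing R] [NonUnitalNonAssocRing A] [Module R A] : Set (A →ₗ[R] A) :=
  {δ | ∀ a b : A, δ (a * b) = δ a * b + a * δ b}

/-! ### The Yau twist of an associative algebra -/

/-- The Yau twist `A^α` of an associative `R`-algebra `A` by an endomorphism `α`: the same
`R`-module, with the product `a * b := α (a · b)` and the twisting map `α`. -/
@[nolint unusedArguments]
def YauTwist {R A : Type*} [CommRing R] [Ring A] [Algebra R A] (_α : A →ₐ[R] A) : Type _ := A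

namespace YauTwist

variable {R A : Type*} [CommRing R] [Ring A] [Algebra R A] (α : A →ₐ[R] A)

instance : AddCommGroup (YauTwist α) := inferInstanceAs (AddCommGroup A)

instance : Module R (YauTwist α) := inferInstanceAs (Module R A)

/-- The identity map from `A` to the underlying module of `A^α`. -/
def of : A ≃ₗ[R] YauTwist α := LinearEquiv.refl R A

instance : Mul (YauTwist α) := ⟨fun a b => of α (α ((of α).symm a * (of α).symm b))⟩

theorem mul_def (a b : YauTwist α) : a * b = of α (α ((of α).symm a * (of α).symm b)) := rfl

theorem of_mul_of (a b : A) : of α a * of α b = of α (α (a * b)) := rfl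

instance : NonUnitalNonAssocRing (YauTwist α) :=
  { (inferInstance : AddCommGroup (YauTwist α)), (inferInstance : Mul (YauTwist α)) with
    left_distrib := fun a b c => by simp [mul_def, mul_add]
    right_distrib := fun a b c => by simp [mul_def, add_mul]
    zero_mul := fun a => by simp [mul_def]
    mul_zero := fun a => by simp [mul_def] }

/-- The twisting map of `A^α`. -/
def twist : YauTwist α →ₗ[R] YauTwist α := (of α).conj α.toLinearMap

/-- `A^α` is a hom-associative algebra. -/
theorem hom_assoc (a b c : YauTwist α) : twist α a * (b * c) = (a * b) * twist α c := by
  simp [mul_def, twist, LinearEquiv.conj_apply, mul_assoc]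

end YauTwist

/-! ### The first Weyl algebra -/

/-- The relation `x y - y x = 1` on the free algebra on two letters, `x = ι 0`, `y = ι 1`. -/
inductive WeylRel (K : Type*) [CommRing K] :
    FreeAlgebra K (Fin 2) → FreeAlgebra K (Fin 2) → Prop
  | comm : WeylRel K
      (FreeAlgebra.ι K 0 * FreeAlgebra.ι K 1 - FreeAlgebra.ι K 1 * FreeAlgebra.ι K 0) 1

/-- The first associative Weyl algebra `A₁ = K⟨x, y⟩ / (x y - y x - 1)`. -/
def Weyl (K : Type*) [CommRing K] : Type _ := RingQuot (WeylRel K)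

namespace Weyl

section basic

variable (K : Type*) [CommRing K]

instance : Ring (Weyl K) := inferInstanceAs (Ring (RingQuot (WeylRel K)))

instance : Algebra K (Weyl K) := inferInstanceAs (Algebra K (RingQuot (WeylRel K)))

/-- The quotient map from the free algebra. -/
def mk : FreeAlgebra K (Fin 2) →ₐ[K] Weyl K := RingQuot.mkAlgHom K (WeylRel K)

/-- The generator `x`. -/
def X : Weyl K := mk K (FreeAlgebra.ι K 0)

/-- The generator `y`. -/
def Y : Weyl K := mk K (FreeAlgebra.ι K 1)

theorem X_mul_Y_sub : X K * Y K - Y K * X K = 1 := by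
  have h : mk K _ = mk K _ := RingQuot.mkAlgHom_rel K (WeylRel.comm (K := K))
  rwa [map_sub, map_mul, map_mul, map_one] at h

variable {K}

/-- The universal property of `A₁`: the algebra map sending `x` to `a` and `y` to `b`. -/
def lift {B : Type*} [Ring B] [Algebra K B] (a b : B) (h : a * b - b * a = 1) :
    Weyl K →ₐ[K] B :=
  RingQuot.liftAlgHom K ⟨FreeAlgebra.lift K ![a, b], by
    rintro _ _ ⟨⟩
    simpa using h⟩

theorem lift_mk {B : Type*} [Ring B] [Algebra K B] (a b : B) (h : a * b - b * a = 1)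
    (z : FreeAlgebra K (Fin 2)) : lift a b h (mk K z) = FreeAlgebra.lift K ![a, b] z :=
  RingQuot.liftAlgHom_mkAlgHom_apply ..

theorem lift_X {B : Type*} [Ring B] [Algebra K B] (a b : B) (h : a * b - b * a = 1) :
    lift a b h (X K) = a := by
  simp [X, lift_mk]

theorem lift_Y {B : Type*} [Ring B] [Algebra K B] (a b : B) (h : a * b - b * a = 1) :
    lift a b h (Y K) = b := by
  simp [Y, lift_mk]

theorem hom_ext {B : Type*} [Ring B] [Algebra K B] {f g : Weyl K →ₐ[K] B}
    (hX : f (X K) = g (X K)) (hY : f (Y K) = g (Y K)) : f = g := by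
  refine RingQuot.ringQuot_ext' (S := K) (s := WeylRel K) f g (FreeAlgebra.hom_ext ?_)
  funext i
  fin_cases i
  · exact hX
  · exact hY

theorem X_mul_Y_pow_sub (n : ℕ) :
    X K * Y K ^ n - Y K ^ n * X K = (n : Weyl K) * Y K ^ (n - 1) := by
  have hXY : X K * Y K = Y K * X K + 1 := sub_eq_iff_eq_add'.mp (X_mul_Y_sub K)
  have h : ∀ n : ℕ, X K * Y K ^ (n + 1) =
      Y K ^ (n + 1) * X K + ((n + 1 : ℕ) : Weyl K) * Y K ^ n := by
    intro n
    induction n with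
    | zero => simpa using hXY
    | succ n ih =>
      rw [pow_succ, ← mul_assoc, ih, add_mul, mul_assoc, hXY, mul_add, mul_one, ← mul_assoc,
        ← pow_succ, mul_assoc, ← pow_succ, Nat.cast_succ (n + 1), add_mul, one_mul]
      abel
  cases n with
  | zero => simp
  | succ n => rw [h n]; simp

/-! #### Derivations of `A₁` given by their values on the generators -/

/-- The algebra map `z ↦ z + ε D(z)` into the trivial square-zero extension of `A₁` by itself,
where `D` is to be the derivation with `D x = a` and `D y = b`. -/
def derivLift (a b : Weyl K) (h : (a * Y K + X K * b) - (b * X K + Y K * a) = 0) :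
    Weyl K →ₐ[K] TrivSqZeroExt (Weyl K) (Weyl K) :=
  lift (TrivSqZeroExt.inl (X K) + TrivSqZeroExt.inr a)
    (TrivSqZeroExt.inl (Y K) + TrivSqZeroExt.inr b) (by
      ext
      · simp [X_mul_Y_sub]
      · simp only [TrivSqZeroExt.snd_sub, TrivSqZeroExt.snd_mul, TrivSqZeroExt.fst_add,
          TrivSqZeroExt.fst_inl, TrivSqZeroExt.fst_inr, TrivSqZeroExt.snd_add,
          TrivSqZeroExt.snd_inl, TrivSqZeroExt.snd_inr, TrivSqZeroExt.snd_one, add_zero, zero_add,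
          smul_eq_mul, MulOpposite.smul_eq_mul_unop, MulOpposite.unop_op]
        rw [← h]; abel)

/-- The derivation `D` of `A₁` with `D x = a` and `D y = b`. It exists as soon as
`[a, y] + [x, b] = 0`. -/
def derivOf (a b : Weyl K) (h : (a * Y K + X K * b) - (b * X K + Y K * a) = 0) :
    Weyl K →ₗ[K] Weyl K :=
  TrivSqZeroExt.sndHom (Weyl K) (Weyl K) |>.restrictScalars K |>.comp
    (derivLift a b h).toLinearMap

theorem derivOf_X (a b : Weyl K) (h) : derivOf a b h (X K) = a := by
  simp [derivOf, derivLift, lift_X]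

theorem derivOf_Y (a b : Weyl K) (h) : derivOf a b h (Y K) = b := by
  simp [derivOf, derivLift, lift_Y]

theorem fst_derivLift (a b : Weyl K) (h) (z : Weyl K) : (derivLift a b h z).fst = z := by
  have : (TrivSqZeroExt.fstHom K (Weyl K) (Weyl K)).comp (derivLift a b h) =
      AlgHom.id K (Weyl K) := by
    apply hom_ext <;> simp [derivLift, lift_X, lift_Y]
  exact DFunLike.congr_fun this z

theorem derivOf_mem_Der (a b : Weyl K) (h) : derivOf a b h ∈ Der K (Weyl K) := by
  intro z w
  simp [derivOf, fst_derivLift, add_comm]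

/-- The derivation `E_x` of `A₁`: `E_x x = y ^ (p - 1)`, `E_x y = 0`. -/
def Ex (K : Type*) [CommRing K] (p : ℕ) : Weyl K →ₗ[K] Weyl K :=
  derivOf (Y K ^ (p - 1)) 0 (by simp [← pow_succ, ← pow_succ'])

/-- The derivation `E_y` of `A₁`: `E_y x = 0`, `E_y y = x ^ (p - 1)`. -/
def Ey (K : Type*) [CommRing K] (p : ℕ) : Weyl K →ₗ[K] Weyl K :=
  derivOf 0 (X K ^ (p - 1)) (by simp [← pow_succ, ← pow_succ'])

theorem Ex_spec (K : Type*) [CommRing K] (p : ℕ) :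
    Ex K p ∈ Der K (Weyl K) ∧ Ex K p (X K) = Y K ^ (p - 1) ∧ Ex K p (Y K) = 0 :=
  ⟨fun z w => derivOf_mem_Der _ _ _ z w, derivOf_X .., derivOf_Y ..⟩

theorem Ey_spec (K : Type*) [CommRing K] (p : ℕ) :
    Ey K p ∈ Der K (Weyl K) ∧ Ey K p (X K) = 0 ∧ Ey K p (Y K) = X K ^ (p - 1) :=
  ⟨fun z w => derivOf_mem_Der _ _ _ z w, derivOf_X .., derivOf_Y ..⟩

/-- The inner derivation `ad_q = [q, ·]` of `A₁`. -/
def ad (q : Weyl K) : Weyl K →ₗ[K] Weyl K := LinearMap.mulLeft K q - LinearMap.mulRight K q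

theorem ad_apply (q a : Weyl K) : ad q a = q * a - a * q := rfl

/-- The element `∑ c_{ij} y^i x^j` of `A₁` with (finitely supported) coefficients `c`. -/
def ofCoeff (c : ℕ × ℕ →₀ K) : Weyl K :=
  c.sum fun ij a => a • (Y K ^ ij.1 * X K ^ ij.2)

/-- The subalgebra `K[x^p, y^p]` of `A₁`. -/
def polyP (K : Type*) [CommRing K] (p : ℕ) : Subalgebra K (Weyl K) :=
  Algebra.adjoin K {X K ^ p, Y K ^ p}

end basic

/-! ### The hom-associative Weyl algebras -/

section twist

variable {K : Type*} [Field K] (p : ℕ) [CharP K p]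

/-- `k₀ + y + k_p y^p + k_{2p} y^{2p} + ⋯`; the entry `k i` stands for `k_{ip}`. -/
def twistY (k : ℕ →₀ K) : Weyl K := Y K + k.sum fun i a => a • Y K ^ (i * p)

theorem X_mul_twistY_sub (k : ℕ →₀ K) :
    X K * twistY p k - twistY p k * X K = 1 := by
  have h0 : ∀ i : ℕ, X K * Y K ^ (i * p) - Y K ^ (i * p) * X K = 0 := by
    intro i
    rw [X_mul_Y_pow_sub, Nat.cast_mul]
    have : ((p : ℕ) : Weyl K) = 0 := by
      rw [← map_natCast (algebraMap K (Weyl K)), CharP.cast_eq_zero, map_zero]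
    simp [this]
  have : X K * twistY p k - twistY p k * X K = (X K * Y K - Y K * X K) +
      k.sum fun i a => a • (X K * Y K ^ (i * p) - Y K ^ (i * p) * X K) := by
    simp only [twistY, mul_add, add_mul, Finsupp.sum, Finset.mul_sum, Finset.sum_mul, smul_sub,
      Finset.sum_sub_distrib, mul_smul_comm, smul_mul_assoc]
    abel
  rw [this, X_mul_Y_sub]
  simp [h0]

/-- The endomorphism `α_k` of `A₁`: `x ↦ x`, `y ↦ k₀ + y + k_p y^p + k_{2p} y^{2p} + ⋯`. -/
def alpha (k : ℕ →₀ K) : Weyl K →ₐ[K] Weyl K :=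
  lift (X K) (twistY p k) (X_mul_twistY_sub p k)

/-- `α_k` is the homogeneous extension to `A₁` of its restriction to `K[y]`. -/
theorem alpha_monomial (k : ℕ →₀ K) (i j : ℕ) :
    alpha p k (Y K ^ i * X K ^ j) = twistY p k ^ i * X K ^ j := by
  simp [alpha, lift_X, lift_Y]

end twist

end Weyl

/-- The hom-associative Weyl algebra `A₁^k`, the Yau twist of `A₁` by `α_k`. -/
abbrev HomWeylAlgebra {K : Type*} [Field K] (p : ℕ) [CharP K p] (k : ℕ →₀ K) : Type _ :=
  YauTwist (Weyl.alpha p k)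

end HomWeyl

end

/-!
A derivation of the twisted product `a * b = α (a b)` is an ordinary derivation of `A₁` commuting
with `α` (`twisted_der_iff`). Indeed, putting `1` for one or both arguments gives a value `c` at `1`
with `c = 2 α c`; as `α ^ p = 1` and `2 ^ p = 2` in `K`, it follows that `c = 0`, and then `α`, being
injective, can be cancelled.

In normal order `[x, ·]` and `-[y, ·]` are the partial derivatives `∂/∂y` and `∂/∂x`
(`coeff_ad_X`, `coeff_ad_Y`); that normal forms are unique is seen from the left regular
representation written on polynomials (`coeff_ofCoeff`, `ofCoeff_coeff`). A derivation `D` thus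
amounts to a pair `(D x, D y)` with `∂(D x)/∂x + ∂(D y)/∂y = 0`. Such a pair can be integrated to an
inner derivation except at the monomials with an exponent congruent to `-1` modulo `p`, and these
make up the multiples of `E_x` and `E_y` by elements of `K[x^p, y^p]` (`exists_stdDer_eq`).

The derivation `u E_x + v E_y + ad_q` commutes with `α` if and only if `α` fixes
`u y^(p-1) - ∂q/∂y` and `v x^(p-1) + ∂q/∂x`. Since `α` commutes with `∂/∂y`, and since
`(∂/∂y)^(p-1)` sends the first of these to `(p-1)! u`, invariance of the first forces that of `u`,
and likewise for `v` (`shift_eq_of_shift_mul_pow_sub_ad`). The binomial theorem expresses what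
remains in coefficients (`stdDer_comm_shift_iff`, `shift_eq_self_iff`, `shift_ad_Y_eq_self_iff`,
`shift_mul_Y_pow_sub_ad_X_eq_self_iff`).
-/

noncomputable section

namespace HomWeyl

namespace Weyl

/-! ### The basis of monomials and partial derivatives -/

section pbw

variable {K : Type*} [CommRing K]

@[elab_as_elim]
theorem induction {P : Weyl K → Prop} (algebraMap : ∀ c : K, P (algebraMap K _ c))
    (X : P (X K)) (Y : P (Y K)) (mul : ∀ a b, P a → P b → P (a * b))
    (add : ∀ a b, P a → P b → P (a + b)) (a : Weyl K) : P a := by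
  obtain ⟨z, rfl⟩ : ∃ z, mk K z = a := RingQuot.mkAlgHom_surjective K (WeylRel K) a
  induction z using FreeAlgebra.induction with
  | grade0 r => simpa using algebraMap r
  | grade1 i => fin_cases i; exacts [X, Y]
  | mul a b ha hb => simpa using mul _ _ ha hb
  | add a b ha hb => simpa using add _ _ ha hb

theorem X_mul_Y_pow (n : ℕ) :
    X K * Y K ^ n = Y K ^ n * X K + (n : Weyl K) * Y K ^ (n - 1) := by
  rw [← X_mul_Y_pow_sub]; abel

/-- Left multiplication by `x` on normally ordered polynomials:
`y^i x^j ↦ y^i x^(j+1) + i y^(i-1) x^j`. -/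
def coeffX (K : Type*) [CommRing K] : Module.End K (ℕ × ℕ →₀ K) :=
  Finsupp.linearCombination K fun ij =>
    Finsupp.single (ij.1, ij.2 + 1) 1 + Finsupp.single (ij.1 - 1, ij.2) (ij.1 : K)

/-- Left multiplication by `y` on normally ordered polynomials: `y^i x^j ↦ y^(i+1) x^j`. -/
def coeffY (K : Type*) [CommRing K] : Module.End K (ℕ × ℕ →₀ K) :=
  Finsupp.linearCombination K fun ij => Finsupp.single (ij.1 + 1, ij.2) 1

theorem coeffX_single (i j : ℕ) (c : K) : coeffX K (Finsupp.single (i, j) c) =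
    Finsupp.single (i, j + 1) c + Finsupp.single (i - 1, j) (c * i) := by
  simp [coeffX]

theorem coeffY_single (i j : ℕ) (c : K) :
    coeffY K (Finsupp.single (i, j) c) = Finsupp.single (i + 1, j) c := by
  simp [coeffY]

theorem coeffX_mul_coeffY_sub : coeffX K * coeffY K - coeffY K * coeffX K = 1 := by
  refine Finsupp.lhom_ext fun ij c => ?_
  obtain ⟨i, j⟩ := ij
  simp only [LinearMap.sub_apply, Module.End.mul_apply, coeffY_single, coeffX_single, map_add,
    Module.End.one_apply]
  cases i with
  | zero => simp
  | succ i => simp [mul_add]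

/-- The left regular representation of `A₁`, written on normally ordered polynomials. -/
def rep (K : Type*) [CommRing K] : Weyl K →ₐ[K] Module.End K (ℕ × ℕ →₀ K) :=
  lift (coeffX K) (coeffY K) coeffX_mul_coeffY_sub

theorem ofCoeff_eq_linearCombination (c : ℕ × ℕ →₀ K) :
    ofCoeff c = Finsupp.linearCombination K (fun ij => Y K ^ ij.1 * X K ^ ij.2) c := rfl

theorem ofCoeff_single (i j : ℕ) (c : K) :
    ofCoeff (Finsupp.single (i, j) c) = c • (Y K ^ i * X K ^ j) := by
  simp [ofCoeff_eq_linearCombination]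

theorem ofCoeff_add (c d : ℕ × ℕ →₀ K) : ofCoeff (c + d) = ofCoeff c + ofCoeff d := by
  simp [ofCoeff_eq_linearCombination]

/-- Reading coefficients back into `A₁` turns the representation into left multiplication; at the
constant polynomial `1` this shows that the monomials `y^i x^j` span. -/
theorem ofCoeff_rep (a : Weyl K) : ∀ c, ofCoeff (rep K a c) = a * ofCoeff c := by
  induction a using induction with
  | algebraMap r =>
    intro c
    simp [ofCoeff_eq_linearCombination, Algebra.algebraMap_eq_smul_one]
  | X =>
    intro c
    induction c using Finsupp.induction_linear with
    | zero => simp [ofCoeff]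
    | add f g hf hg => rw [map_add, ofCoeff_add, ofCoeff_add, hf, hg, mul_add]
    | single ij c =>
      obtain ⟨i, j⟩ := ij
      rw [rep, lift_X, coeffX_single, ofCoeff_add, ofCoeff_single, ofCoeff_single, ofCoeff_single,
        mul_smul_comm, ← mul_assoc, X_mul_Y_pow, add_mul, mul_assoc, ← pow_succ', smul_add,
        mul_assoc, mul_smul, ← nsmul_eq_mul, Nat.cast_smul_eq_nsmul]
  | Y =>
    intro c
    induction c using Finsupp.induction_linear with
    | zero => simp [ofCoeff]
    | add f g hf hg => rw [map_add, ofCoeff_add, ofCoeff_add, hf, hg, mul_add]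
    | single ij c =>
      obtain ⟨i, j⟩ := ij
      rw [rep, lift_Y, coeffY_single, ofCoeff_single, ofCoeff_single, mul_smul_comm, ← mul_assoc,
        ← pow_succ']
  | mul a b ha hb => intro c; rw [map_mul, Module.End.mul_apply, ha, hb, mul_assoc]
  | add a b ha hb => intro c; rw [map_add, LinearMap.add_apply, ofCoeff_add, ha, hb, add_mul]

/-- The coefficients of an element of `A₁` in the basis `y^i x^j`: apply the left regular
representation to the constant polynomial `1`. -/
def coeff : Weyl K →ₗ[K] (ℕ × ℕ →₀ K) :=
  LinearMap.applyₗ (Finsupp.single (0, 0) 1) ∘ₗ (rep K).toLinearMap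

theorem coeff_apply (a : Weyl K) : coeff a = rep K a (Finsupp.single (0, 0) 1) := rfl

theorem ofCoeff_coeff (a : Weyl K) : ofCoeff (coeff a) = a := by
  rw [coeff_apply, ofCoeff_rep, ofCoeff_single]; simp

theorem coeff_monomial (i j : ℕ) : coeff (Y K ^ i * X K ^ j) = Finsupp.single (i, j) 1 := by
  have hX : (coeffX K ^ j) (Finsupp.single (0, 0) 1) = Finsupp.single (0, j) 1 := by
    induction j with
    | zero => simp
    | succ j ih => rw [pow_succ', Module.End.mul_apply, ih, coeffX_single]; simp
  rw [coeff_apply, map_mul, map_pow, map_pow, rep, lift_X, lift_Y, Module.End.mul_apply, hX]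
  induction i with
  | zero => simp
  | succ i ih => rw [pow_succ', Module.End.mul_apply, ih, coeffY_single]

/-- The monomials `y^i x^j` are linearly independent. -/
theorem coeff_ofCoeff (c : ℕ × ℕ →₀ K) : coeff (ofCoeff c) = c := by
  induction c using Finsupp.induction_linear with
  | zero => simp [ofCoeff]
  | add f g hf hg => rw [ofCoeff_add, map_add, hf, hg]
  | single ij c => rw [ofCoeff_single, map_smul, coeff_monomial]; simp

theorem ext_coeff {a b : Weyl K} (h : ∀ i j, coeff a (i, j) = coeff b (i, j)) : a = b := by
  rw [← ofCoeff_coeff a, ← ofCoeff_coeff b]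
  congr 1
  ext ⟨i, j⟩
  exact h i j

@[elab_as_elim]
theorem induction_monomial {P : Weyl K → Prop} (zero : P 0)
    (monomial : ∀ (c : K) (i j : ℕ), P (c • (Y K ^ i * X K ^ j)))
    (add : ∀ a b, P a → P b → P (a + b)) (a : Weyl K) : P a := by
  rw [← ofCoeff_coeff a]
  induction coeff a using Finsupp.induction_linear with
  | zero => simpa [ofCoeff] using zero
  | add f g hf hg => rw [ofCoeff_add]; exact add _ _ hf hg
  | single ij c => rw [ofCoeff_single]; exact monomial _ _ _

theorem coeff_Y_pow_mul (n : ℕ) (a : Weyl K) (i j : ℕ) :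
    coeff (Y K ^ n * a) (i, j) = if n ≤ i then coeff a (i - n, j) else 0 := by
  induction a using induction_monomial with
  | zero => simp
  | add a b ha hb => simp only [mul_add, map_add, Finsupp.add_apply, ha, hb]; split_ifs <;> simp
  | monomial c k l =>
    rw [mul_smul_comm, ← mul_assoc, ← pow_add]
    simp only [map_smul, coeff_monomial, Finsupp.smul_apply, Finsupp.single_apply, Prod.mk.injEq]
    split_ifs <;> first | rfl | omega | simp

theorem coeff_mul_X_pow (n : ℕ) (a : Weyl K) (i j : ℕ) :
    coeff (a * X K ^ n) (i, j) = if n ≤ j then coeff a (i, j - n) else 0 := by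
  induction a using induction_monomial with
  | zero => simp
  | add a b ha hb => simp only [add_mul, map_add, Finsupp.add_apply, ha, hb]; split_ifs <;> simp
  | monomial c k l =>
    rw [smul_mul_assoc, mul_assoc, ← pow_add]
    simp only [map_smul, coeff_monomial, Finsupp.smul_apply, Finsupp.single_apply, Prod.mk.injEq]
    split_ifs <;> first | rfl | omega | simp

theorem ad_mul (q a b : Weyl K) : ad q (a * b) = ad q a * b + a * ad q b := by
  simp only [ad_apply]; noncomm_ring

theorem ad_X_Y : ad (X K) (Y K) = 1 := by rw [ad_apply, X_mul_Y_sub]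

theorem ad_Y_X : ad (Y K) (X K) = -1 := by rw [ad_apply, ← X_mul_Y_sub, neg_sub]

theorem ad_self (a : Weyl K) : ad a a = 0 := by simp [ad_apply]

theorem ad_skew (q a : Weyl K) : -ad q a = ad a q := by rw [ad_apply, ad_apply, neg_sub]

/-- The commutator with `z` differentiates powers of `w` when `[z, w]` is the scalar `s`. -/
theorem ad_pow_of_ad_eq {z w : Weyl K} {s : K} (h : ad z w = algebraMap K _ s) (n : ℕ) :
    ad z (w ^ n) = ((n : K) * s) • w ^ (n - 1) := by
  induction n with
  | zero => simp [ad_apply]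
  | succ n ih =>
    rw [pow_succ, ad_mul, ih, h, Algebra.algebraMap_eq_smul_one]
    cases n with
    | zero => simp
    | succ n =>
      simp only [Nat.add_sub_cancel, smul_mul_assoc, mul_smul_comm, mul_one, ← pow_succ,
        ← add_smul]
      push_cast
      ring_nf

/-- In normal order `[x, ·]` is the partial derivative with respect to `y`. -/
theorem coeff_ad_X (a : Weyl K) (i j : ℕ) :
    coeff (ad (X K) a) (i, j) = (i + 1) * coeff a (i + 1, j) := by
  induction a using induction_monomial with
  | zero => simp
  | add a b ha hb => simp only [map_add, Finsupp.add_apply, ha, hb, mul_add]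
  | monomial c k l =>
    have h : ad (X K) (Y K) = algebraMap K _ 1 := by rw [ad_X_Y, map_one]
    have h' : ad (X K) (X K) = algebraMap K _ 0 := by rw [ad_self, map_zero]
    rw [map_smul, ad_mul, ad_pow_of_ad_eq h, ad_pow_of_ad_eq h']
    simp only [mul_zero, mul_one, zero_smul, add_zero, smul_mul_assoc, map_smul, coeff_monomial,
      Finsupp.smul_apply, Finsupp.single_apply, Prod.mk.injEq, smul_eq_mul]
    rcases k with _ | k
    · simp
    · by_cases hk : k = i ∧ l = j
      · obtain ⟨rfl, rfl⟩ := hk; simp; ring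
      · simp [hk]

/-- In normal order `-[y, ·]` is the partial derivative with respect to `x`. -/
theorem coeff_ad_Y (a : Weyl K) (i j : ℕ) :
    coeff (ad (Y K) a) (i, j) = -((j + 1) * coeff a (i, j + 1)) := by
  induction a using induction_monomial with
  | zero => simp
  | add a b ha hb => simp only [map_add, Finsupp.add_apply, ha, hb, mul_add, neg_add]
  | monomial c k l =>
    have h : ad (Y K) (X K) = algebraMap K _ (-1) := by rw [ad_Y_X, map_neg, map_one]
    have h' : ad (Y K) (Y K) = algebraMap K _ 0 := by rw [ad_self, map_zero]
    rw [map_smul, ad_mul, ad_pow_of_ad_eq h, ad_pow_of_ad_eq h']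
    simp only [mul_zero, mul_neg, mul_one, zero_smul, zero_mul, zero_add, mul_smul_comm, map_smul,
      coeff_monomial, Finsupp.smul_apply, Finsupp.single_apply, Prod.mk.injEq, smul_eq_mul]
    rcases l with _ | l
    · simp
    · by_cases hk : k = i ∧ l = j
      · obtain ⟨rfl, rfl⟩ := hk; simp; ring
      · simp [hk]

end pbw

/-! ### Derivations in positive characteristic -/

section derivations

theorem der_one {K : Type*} [CommRing K] {D : Weyl K →ₗ[K] Weyl K} (hD : D ∈ Der K (Weyl K)) :
    D 1 = 0 := by
  have h := hD 1 1
  simpa using h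

theorem der_algebraMap {K : Type*} [CommRing K] {D : Weyl K →ₗ[K] Weyl K}
    (hD : D ∈ Der K (Weyl K)) (c : K) : D (algebraMap K _ c) = 0 := by
  rw [Algebra.algebraMap_eq_smul_one, map_smul, der_one hD, smul_zero]

theorem der_ext {K : Type*} [CommRing K] {D E : Weyl K →ₗ[K] Weyl K} (hD : D ∈ Der K (Weyl K))
    (hE : E ∈ Der K (Weyl K)) (hX : D (X K) = E (X K)) (hY : D (Y K) = E (Y K)) : D = E := by
  ext a
  induction a using induction with
  | algebraMap c => rw [der_algebraMap hD, der_algebraMap hE]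
  | X => exact hX
  | Y => exact hY
  | mul a b ha hb => rw [hD, hE, ha, hb]
  | add a b ha hb => rw [map_add, map_add, ha, hb]

/-- A derivation commutes with an algebra endomorphism as soon as it does so on the generators. -/
theorem der_comp_comm {K : Type*} [CommRing K] {D : Weyl K →ₗ[K] Weyl K}
    (hD : D ∈ Der K (Weyl K)) (f : Weyl K →ₐ[K] Weyl K) (hX : D (f (X K)) = f (D (X K)))
    (hY : D (f (Y K)) = f (D (Y K))) (a : Weyl K) : D (f a) = f (D a) := by
  induction a using induction with
  | algebraMap c => rw [AlgHom.commutes, der_algebraMap hD, map_zero]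
  | X => exact hX
  | Y => exact hY
  | mul a b ha hb => rw [map_mul, hD, hD, ha, hb, map_add, map_mul, map_mul]
  | add a b ha hb => simp only [map_add, ha, hb]

/-- `u E_x + v E_y + ad_q`. -/
def stdDer {K : Type*} [CommRing K] (p : ℕ) (u v q : Weyl K) : Weyl K →ₗ[K] Weyl K :=
  LinearMap.mulLeft K u ∘ₗ Ex K p + LinearMap.mulLeft K v ∘ₗ Ey K p + ad q

theorem stdDer_apply {K : Type*} [CommRing K] (p : ℕ) (u v q a : Weyl K) :
    stdDer p u v q a = u * Ex K p a + v * Ey K p a + ad q a := rfl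

theorem stdDer_X {K : Type*} [CommRing K] (p : ℕ) (u v q : Weyl K) :
    stdDer p u v q (X K) = u * Y K ^ (p - 1) - ad (X K) q := by
  rw [stdDer_apply, (Ex_spec K p).2.1, (Ey_spec K p).2.1, ← ad_skew (X K)]
  simp [sub_eq_add_neg]

theorem stdDer_Y {K : Type*} [CommRing K] (p : ℕ) (u v q : Weyl K) :
    stdDer p u v q (Y K) = v * X K ^ (p - 1) - ad (Y K) q := by
  rw [stdDer_apply, (Ex_spec K p).2.2, (Ey_spec K p).2.2, ← ad_skew (Y K)]
  simp [sub_eq_add_neg]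

variable {K : Type*} [Field K] (p : ℕ) [CharP K p]

theorem natCast_weyl_eq_zero : (p : Weyl K) = 0 := by
  rw [← map_natCast (algebraMap K (Weyl K)), CharP.cast_eq_zero, map_zero]

theorem ad_X_pow_char : ad (X K ^ p) = 0 := by
  have h : ad (Y K) (X K) = algebraMap K _ (-1) := by rw [ad_Y_X, map_neg, map_one]
  refine der_ext (ad_mul _) (fun _ _ => by simp) ?_ ?_
  · simp [ad_apply, ← pow_succ, ← pow_succ']
  · rw [← ad_skew, ad_pow_of_ad_eq h, CharP.cast_eq_zero]; simp

theorem ad_Y_pow_char : ad (Y K ^ p) = 0 := by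
  have h : ad (X K) (Y K) = algebraMap K _ 1 := by rw [ad_X_Y, map_one]
  refine der_ext (ad_mul _) (fun _ _ => by simp) ?_ ?_
  · rw [← ad_skew, ad_pow_of_ad_eq h, CharP.cast_eq_zero]; simp
  · simp [ad_apply, ← pow_succ, ← pow_succ']

/-- The powers `x^p` and `y^p` are central, as commutators with them are derivatives of `p`-th
powers. -/
theorem polyP_le_center : polyP K p ≤ Subalgebra.center K (Weyl K) := by
  refine Algebra.adjoin_le ?_
  have key : ∀ z : Weyl K, ad z = 0 → z ∈ Subalgebra.center K (Weyl K) := fun z hz =>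
    Subalgebra.mem_center_iff.mpr fun b => by
      have := DFunLike.congr_fun hz b
      rw [ad_apply, LinearMap.zero_apply, sub_eq_zero] at this
      exact this.symm
  rintro z (rfl | rfl)
  · exact key _ (ad_X_pow_char p)
  · exact key _ (ad_Y_pow_char p)

theorem polyP_comm {u : Weyl K} (hu : u ∈ polyP K p) (a : Weyl K) : a * u = u * a :=
  Subalgebra.mem_center_iff.mp (polyP_le_center p hu) a

theorem stdDer_mem_Der {u v : Weyl K} (hu : u ∈ polyP K p) (hv : v ∈ polyP K p) (q : Weyl K) :
    stdDer p u v q ∈ Der K (Weyl K) := by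
  intro a b
  simp only [stdDer_apply, (Ex_spec K p).1 a b, (Ey_spec K p).1 a b, ad_mul, mul_add, add_mul]
  simp only [← mul_assoc, polyP_comm p hu a, polyP_comm p hv a]
  abel

theorem ofCoeff_mem_polyP {c : ℕ × ℕ →₀ K}
    (hc : ∀ i j, c (i, j) ≠ 0 → (i : K) = 0 ∧ (j : K) = 0) : ofCoeff c ∈ polyP K p := by
  refine Subalgebra.sum_mem _ fun ij hij => Subalgebra.smul_mem _ ?_ _
  obtain ⟨i, j⟩ := ij
  obtain ⟨hi, hj⟩ := hc i j (Finsupp.mem_support_iff.mp hij)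
  obtain ⟨m, rfl⟩ := (CharP.cast_eq_zero_iff K p i).mp hi
  obtain ⟨n, rfl⟩ := (CharP.cast_eq_zero_iff K p j).mp hj
  rw [pow_mul, pow_mul]
  exact mul_mem (pow_mem (Algebra.subset_adjoin (by simp)) _)
    (pow_mem (Algebra.subset_adjoin (by simp)) _)

/-- Closedness of the form with coefficients `D x` and `D y`, in terms of normally ordered
coefficients. -/
theorem der_closed {K : Type*} [CommRing K] {D : Weyl K →ₗ[K] Weyl K} (hD : D ∈ Der K (Weyl K))
    (i j : ℕ) : ((j : K) + 1) * coeff (D (X K)) (i, j + 1) +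
      ((i : K) + 1) * coeff (D (Y K)) (i + 1, j) = 0 := by
  have h : ad (X K) (D (Y K)) - ad (Y K) (D (X K)) = 0 := by
    have h1 := congrArg D (X_mul_Y_sub K)
    rw [map_sub, hD, hD, der_one hD] at h1
    rw [← h1, ad_apply, ad_apply]
    abel
  have := DFunLike.congr_fun (congrArg coeff h) (i, j)
  rw [map_sub, Finsupp.sub_apply, coeff_ad_X, coeff_ad_Y, map_zero, Finsupp.zero_apply] at this
  linear_combination this

/-- Every derivation of `A₁` is `u E_x + v E_y + ad_q` with `u`, `v` in `K[x^p, y^p]`: integrate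
the closed form `(D x, D y)` wherever an exponent is invertible in `K`. -/
theorem exists_stdDer_eq [Fact p.Prime] {D : Weyl K →ₗ[K] Weyl K} (hD : D ∈ Der K (Weyl K)) :
    ∃ u v q : ℕ × ℕ →₀ K, ofCoeff u ∈ polyP K p ∧ ofCoeff v ∈ polyP K p ∧
      D = stdDer p (ofCoeff u) (ofCoeff v) (ofCoeff q) := by
  classical
  have hp : 1 ≤ p := (Fact.out : p.Prime).one_le
  have hpK : (p : K) = 0 := CharP.cast_eq_zero K p
  set a := coeff (D (X K)) with ha
  set b := coeff (D (Y K)) with hb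
  have hab := der_closed hD
  rw [← ha, ← hb] at hab
  let u : ℕ × ℕ →₀ K := Finsupp.ofSupportFinite
    (fun ij => if (ij.1 : K) = 0 ∧ (ij.2 : K) = 0 then a (ij.1 + (p - 1), ij.2) else 0) (by
      refine (a.support.image fun ij => (ij.1 - (p - 1), ij.2)).finite_toSet.subset ?_
      rintro ⟨i, j⟩ h
      simp only [Function.mem_support, ne_eq, ite_eq_right_iff, not_forall] at h
      obtain ⟨-, h⟩ := h
      exact Finset.mem_coe.mpr (Finset.mem_image.mpr ⟨_, Finsupp.mem_support_iff.mpr h, by simp⟩))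
  let v : ℕ × ℕ →₀ K := Finsupp.ofSupportFinite
    (fun ij => if (ij.1 : K) = 0 ∧ (ij.2 : K) = 0 then b (ij.1, ij.2 + (p - 1)) else 0) (by
      refine (b.support.image fun ij => (ij.1, ij.2 - (p - 1))).finite_toSet.subset ?_
      rintro ⟨i, j⟩ h
      simp only [Function.mem_support, ne_eq, ite_eq_right_iff, not_forall] at h
      obtain ⟨-, h⟩ := h
      exact Finset.mem_coe.mpr (Finset.mem_image.mpr ⟨_, Finsupp.mem_support_iff.mpr h, by simp⟩))
  -- If both exponents vanish in `K`, the second branch is a division by zero, which gives `0`.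
  let q : ℕ × ℕ →₀ K := Finsupp.ofSupportFinite
    (fun ij => if (ij.1 : K) = 0 then b (ij.1, ij.2 - 1) / ij.2
      else -a (ij.1 - 1, ij.2) / ij.1) (by
      refine ((b.support.image fun ij => (ij.1, ij.2 + 1)) ∪
        (a.support.image fun ij => (ij.1 + 1, ij.2))).finite_toSet.subset ?_
      rintro ⟨i, j⟩ h
      simp only [Function.mem_support] at h
      rw [Finset.coe_union]
      split_ifs at h with hi
      · left
        rcases j with _ | j
        · simp at h
        · refine Finset.mem_coe.mpr (Finset.mem_image.mpr ⟨(i, j), ?_, rfl⟩)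
          exact Finsupp.mem_support_iff.mpr fun h0 => h (by simp [h0])
      · right
        rcases i with _ | i
        · simp at hi
        · refine Finset.mem_coe.mpr (Finset.mem_image.mpr ⟨(i, j), ?_, rfl⟩)
          exact Finsupp.mem_support_iff.mpr fun h0 => h (by simp [h0]))
  have hu_apply : ∀ i j : ℕ, u (i, j) =
      if (i : K) = 0 ∧ (j : K) = 0 then a (i + (p - 1), j) else 0 := fun _ _ => rfl
  have hv_apply : ∀ i j : ℕ, v (i, j) =
      if (i : K) = 0 ∧ (j : K) = 0 then b (i, j + (p - 1)) else 0 := fun _ _ => rfl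
  have hq_apply : ∀ i j : ℕ, q (i, j) =
      if (i : K) = 0 then b (i, j - 1) / j else -a (i - 1, j) / i := fun _ _ => rfl
  clear_value u v q
  have hu : ofCoeff u ∈ polyP K p := ofCoeff_mem_polyP p fun i j h => by
    by_contra h'
    exact h (by rw [hu_apply, if_neg h'])
  have hv : ofCoeff v ∈ polyP K p := ofCoeff_mem_polyP p fun i j h => by
    by_contra h'
    exact h (by rw [hv_apply, if_neg h'])
  -- `k + 1` vanishes in `K` only for `k = m + (p - 1)` with `m` vanishing in `K`
  have hcast : ∀ k : ℕ, p - 1 ≤ k → ((k - (p - 1) : ℕ) : K) = k + 1 := fun k hk => by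
    rw [Nat.cast_sub hk, Nat.cast_sub hp, hpK, Nat.cast_one]; ring
  have hle : ∀ k : ℕ, (k : K) + 1 = 0 → p - 1 ≤ k := fun k hk => by
    have : p ∣ k + 1 := (CharP.cast_eq_zero_iff K p _).mp (by push_cast; exact hk)
    have := Nat.le_of_dvd (by omega) this
    omega
  refine ⟨u, v, q, hu, hv, der_ext hD (stdDer_mem_Der p hu hv _) (ext_coeff fun i j => ?_)
    (ext_coeff fun i j => ?_)⟩
  · rw [stdDer_X, ← ha, map_sub, Finsupp.sub_apply, coeff_ad_X, ← polyP_comm p hu,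
      coeff_Y_pow_mul, coeff_ofCoeff, coeff_ofCoeff, hq_apply, Nat.cast_succ, hu_apply]
    by_cases hi : (i : K) + 1 = 0
    · rw [if_pos (hle i hi), hcast i (hle i hi), Nat.sub_add_cancel (hle i hi), hi]
      by_cases hj : (j : K) = 0
      · simp [hj]
      · rcases j with _ | j
        · simp at hj
        · have := hab i j
          rw [hi, zero_mul, add_zero] at this
          rw [Nat.cast_succ] at hj
          simpa [hj] using this
    · rw [if_neg hi]
      have : (if p - 1 ≤ i then
          (if ((i - (p - 1) : ℕ) : K) = 0 ∧ (j : K) = 0 then a (i - (p - 1) + (p - 1), j) else 0)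
          else 0) = 0 := by
        split_ifs with h1 h2
        · exact absurd ((hcast i h1).symm.trans h2.1) hi
        · rfl
        · rfl
      rw [this, Nat.add_sub_cancel]
      field_simp
      ring
  · rw [stdDer_Y, ← hb, map_sub, Finsupp.sub_apply, coeff_ad_Y, coeff_mul_X_pow, coeff_ofCoeff,
      coeff_ofCoeff, hq_apply, Nat.cast_succ, hv_apply, Nat.add_sub_cancel]
    by_cases hj : (j : K) + 1 = 0
    · rw [if_pos (hle j hj), hcast j (hle j hj), Nat.sub_add_cancel (hle j hj), hj]
      by_cases hi : (i : K) = 0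
      · simp [hi]
      · rcases i with _ | i
        · simp at hi
        · have := hab i j
          rw [hj, zero_mul, zero_add] at this
          rw [Nat.cast_succ] at hi
          simpa [hi] using this
    · have : (if p - 1 ≤ j then
          (if (i : K) = 0 ∧ ((j - (p - 1) : ℕ) : K) = 0 then b (i, j - (p - 1) + (p - 1)) else 0)
          else 0) = 0 := by
        split_ifs with h1 h2
        · exact absurd ((hcast j h1).symm.trans h2.2) hj
        · rfl
        · rfl
      rw [this]
      by_cases hi : (i : K) = 0
      · rw [if_pos hi]
        field_simp
        ring
      · rw [if_neg hi]
        rcases i with _ | i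
        · simp at hi
        · have := hab i j
          rw [Nat.cast_succ] at hi
          rw [Nat.cast_succ, Nat.add_sub_cancel]
          field_simp
          linear_combination this

end derivations

/-! ### Derivations of the Yau twist and invariance under the shift -/

section shift

variable {K : Type*} [Field K] (p : ℕ) [CharP K p] (k₀ : K)

/-- The automorphism `x ↦ x`, `y ↦ y + k₀` of `A₁`. -/
abbrev shift : Weyl K →ₐ[K] Weyl K := alpha p (Finsupp.single 0 k₀)

theorem shift_X : shift p k₀ (X K) = X K := lift_X ..

theorem shift_Y : shift p k₀ (Y K) = Y K + algebraMap K _ k₀ := by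
  refine (lift_Y ..).trans ?_
  rw [twistY, Finsupp.sum_single_index (by simp), Algebra.algebraMap_eq_smul_one]
  simp

theorem shift_ad_X (a : Weyl K) : shift p k₀ (ad (X K) a) = ad (X K) (shift p k₀ a) := by
  simp only [ad_apply, map_sub, map_mul, shift_X]

theorem shift_ad_Y (a : Weyl K) : shift p k₀ (ad (Y K) a) = ad (Y K) (shift p k₀ a) := by
  simp only [ad_apply, map_sub, map_mul, shift_Y, add_mul, mul_add, Algebra.commutes]
  abel

theorem shift_pow_char : shift p k₀ ^ p = 1 := by
  have h : ∀ n : ℕ, (shift p k₀ ^ n) (X K) = X K ∧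
      (shift p k₀ ^ n) (Y K) = Y K + algebraMap K _ (n * k₀) := by
    intro n
    induction n with
    | zero => simp
    | succ n ih =>
      rw [pow_succ', AlgHom.mul_apply, AlgHom.mul_apply, ih.1, ih.2, map_add, shift_X, shift_Y,
        AlgHom.commutes, add_assoc, ← map_add]
      exact ⟨rfl, by rw [Nat.cast_succ, add_one_mul, add_comm k₀]⟩
  obtain ⟨h1, h2⟩ := h p
  refine hom_ext ?_ ?_
  · simpa using h1
  · simpa [natCast_weyl_eq_zero] using h2

/-- Since `shift` has order `p` and `2 ^ p = 2` in `K`, it has no eigenvalue `1 / 2`. -/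
theorem eq_zero_of_eq_two_smul_shift [Fact p.Prime] {c : Weyl K}
    (h : c = (2 : K) • shift p k₀ c) : c = 0 := by
  have hn : ∀ n : ℕ, c = (2 : K) ^ n • (shift p k₀ ^ n) c := by
    intro n
    induction n with
    | zero => simp
    | succ n ih =>
      conv_lhs => rw [h, ih]
      rw [map_smul, smul_smul, pow_succ' (shift p k₀), pow_succ', AlgHom.mul_apply]
  have h2 : (2 : K) ^ p = 2 := by
    have := add_pow_char (1 : K) 1 p
    rwa [one_pow, one_add_one_eq_two] at this
  have := hn p
  rw [shift_pow_char, h2, AlgHom.one_apply, two_smul] at this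
  simpa using this

/-- Derivations of the Yau twist are the derivations of `A₁` that commute with the twisting
map. The value `c` at `1` satisfies `c = 2 shift c`, hence vanishes. -/
theorem twisted_der_iff [Fact p.Prime] (d : Weyl K →ₗ[K] Weyl K) :
    (∀ a b, d (shift p k₀ (a * b)) = shift p k₀ (d a * b + a * d b)) ↔
      d ∈ Der K (Weyl K) ∧ ∀ a, d (shift p k₀ a) = shift p k₀ (d a) := by
  constructor
  · intro h
    have hinj : Function.Injective (shift p k₀) := by
      intro a b hab
      have hpow : shift p k₀ ^ p = shift p k₀ ^ (p - 1) * shift p k₀ := by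
        rw [← pow_succ, Nat.sub_add_cancel (Fact.out : p.Prime).one_le]
      have hid : ∀ z, (shift p k₀ ^ (p - 1)) (shift p k₀ z) = z := fun z => by
        rw [← AlgHom.mul_apply, ← hpow, shift_pow_char, AlgHom.one_apply]
      rw [← hid a, hab, hid]
    have h1 : d 1 = 0 := by
      refine eq_zero_of_eq_two_smul_shift p k₀ ?_
      have := h 1 1
      rw [mul_one, map_one, mul_one, one_mul, ← two_smul K, map_smul] at this
      exact this
    have hcomm : ∀ a, d (shift p k₀ a) = shift p k₀ (d a) := fun a => by
      simpa [h1] using h a 1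
    exact ⟨fun a b => hinj ((hcomm _).symm.trans (h a b)), hcomm⟩
  · rintro ⟨hd, hcomm⟩ a b
    rw [hcomm, hd]

theorem ad_pow_mul_pow {u z w : Weyl K} (hu : ∀ a, a * u = u * a) {s : K}
    (h : ad z w = algebraMap K _ s) (n : ℕ) :
    (ad z ^ n) (u * w ^ n) = ((n.factorial : K) * s ^ n) • u := by
  induction n with
  | zero => simp
  | succ n ih =>
    have hz : ad z u = 0 := by rw [ad_apply, hu, sub_self]
    rw [pow_succ, Module.End.mul_apply, ad_mul, hz, zero_mul, zero_add, ad_pow_of_ad_eq h,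
      mul_smul_comm, map_smul, Nat.add_sub_cancel, ih, smul_smul, Nat.factorial_succ]
    congr 1
    push_cast
    ring

/-- In characteristic `p`, `(ad z) ^ p = ad (z ^ p)`, because left and right multiplication by `z`
commute. -/
theorem ad_pow_char_of_pow_char [Fact p.Prime] {z : Weyl K} (hz : ad (z ^ p) = 0) :
    ad z ^ p = 0 := by
  have hEnd : CharP (Module.End K (Weyl K)) p := by
    have : Nontrivial (Weyl K) :=
      ⟨⟨1, 0, fun h => by
        have := coeff_monomial (K := K) 0 0
        rw [pow_zero, pow_zero, mul_one, h, map_zero] at this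
        simpa using DFunLike.congr_fun this (0, 0)⟩⟩
    exact charP_of_injective_algebraMap (algebraMap K (Module.End K (Weyl K))).injective p
  have h := sub_pow_char_of_commute p (LinearMap.commute_mulLeft_right (R := K) z z)
  rw [← hz, ad, ad, ← LinearMap.pow_mulLeft, ← LinearMap.pow_mulRight]
  simpa using h

/-- If `[z, w]` is a nonzero scalar, applying `(ad z) ^ (p - 1)` to `u w ^ (p - 1) - [z, q]`
recovers the central element `u` up to a nonzero scalar. -/
theorem shift_eq_of_shift_mul_pow_sub_ad [Fact p.Prime] {u z w q : Weyl K}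
    (hu : ∀ a, a * u = u * a) {s : K} (hs : s ≠ 0) (h : ad z w = algebraMap K _ s)
    (hz : ad (z ^ p) = 0) (hzs : ∀ a, shift p k₀ (ad z a) = ad z (shift p k₀ a))
    (hinv : shift p k₀ (u * w ^ (p - 1) - ad z q) = u * w ^ (p - 1) - ad z q) :
    shift p k₀ u = u := by
  have hpow : ∀ (n : ℕ) (a : Weyl K), shift p k₀ ((ad z ^ n) a) = (ad z ^ n) (shift p k₀ a) := by
    intro n
    induction n with
    | zero => simp
    | succ n ih =>
      intro a
      rw [pow_succ, Module.End.mul_apply, Module.End.mul_apply, ih, hzs]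
  have hq : (ad z ^ (p - 1)) (ad z q) = 0 := by
    rw [← Module.End.mul_apply, ← pow_succ, Nat.sub_add_cancel (Fact.out : p.Prime).one_le,
      ad_pow_char_of_pow_char p hz, LinearMap.zero_apply]
  have hc : ((p - 1).factorial : K) * s ^ (p - 1) ≠ 0 := by
    refine mul_ne_zero (fun h0 => ?_) (pow_ne_zero _ hs)
    have := ((Fact.out : p.Prime).dvd_factorial).mp ((CharP.cast_eq_zero_iff K p _).mp h0)
    have := (Fact.out : p.Prime).pos
    omega
  have := hpow (p - 1) (u * w ^ (p - 1) - ad z q)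
  rw [hinv, map_sub, hq, sub_zero, ad_pow_mul_pow hu h, map_smul] at this
  exact smul_right_injective _ hc this

/-- The coefficients of `shift a - a`, by the binomial theorem; the factor `k₀ ^ l` avoids the
truncated exponent `i - l`. -/
theorem pow_mul_coeff_shift_sub (a : Weyl K) (l j : ℕ) :
    k₀ ^ l * coeff (shift p k₀ a - a) (l, j) =
      ∑ᶠ i ∈ Set.Ici (l + 1), (i.choose l : K) * coeff a (i, j) * k₀ ^ i := by
  have hfin : ∀ b : Weyl K, (Set.Ici (l + 1) ∩
      Function.support fun i : ℕ => (i.choose l : K) * coeff b (i, j) * k₀ ^ i).Finite := by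
    intro b
    refine ((coeff b).support.image Prod.fst).finite_toSet.subset ?_
    rintro i ⟨-, hi⟩
    refine Finset.mem_coe.mpr (Finset.mem_image.mpr ⟨(i, j), ?_, rfl⟩)
    exact Finsupp.mem_support_iff.mpr fun h0 => hi (by simp [h0])
  induction a using induction_monomial with
  | zero => simp
  | add a b ha hb =>
    have h1 : shift p k₀ (a + b) - (a + b) = (shift p k₀ a - a) + (shift p k₀ b - b) := by
      rw [map_add]; abel
    rw [h1, map_add, Finsupp.add_apply, mul_add, ha, hb,
      ← finsum_mem_add_distrib' (hfin a) (hfin b)]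
    refine finsum_mem_congr rfl fun i _ => ?_
    rw [map_add, Finsupp.add_apply]; ring
  | monomial c m n =>
    have hbin : shift p k₀ (Y K ^ m * X K ^ n) =
        ∑ i ∈ Finset.range (m + 1), (k₀ ^ (m - i) * m.choose i) • (Y K ^ i * X K ^ n) := by
      rw [map_mul, map_pow, map_pow, shift_X, shift_Y,
        (Algebra.commute_algebraMap_right k₀ (Y K)).add_pow, Finset.sum_mul]
      refine Finset.sum_congr rfl fun i _ => ?_
      rw [← map_pow, ← map_natCast (algebraMap K (Weyl K))]
      simp only [Algebra.algebraMap_eq_smul_one, mul_smul_comm, smul_mul_assoc, mul_one,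
        smul_smul, mul_comm]
    have hL : coeff (shift p k₀ (Y K ^ m * X K ^ n) - Y K ^ m * X K ^ n) (l, j) =
        if n = j ∧ l < m then k₀ ^ (m - l) * m.choose l else 0 := by
      rw [hbin, Finset.sum_range_succ, Nat.sub_self, pow_zero, Nat.choose_self, Nat.cast_one,
        one_mul, one_smul, add_sub_cancel_right, map_sum, Finsupp.finsetSum_apply]
      simp only [map_smul, coeff_monomial, Finsupp.smul_apply, Finsupp.single_apply,
        Prod.mk.injEq, smul_eq_mul]
      by_cases hn : n = j
      · simp [hn]
      · simp [hn]
    rw [map_smul, ← smul_sub, map_smul, Finsupp.smul_apply, hL]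
    simp only [map_smul, coeff_monomial, Finsupp.smul_apply, Finsupp.single_apply,
      Prod.mk.injEq, smul_eq_mul]
    split_ifs with h
    · obtain ⟨rfl, hl⟩ := h
      rw [finsum_eq_single _ m]
      · rw [finsum_eq_single _ (Set.mem_Ici.mpr hl) (by simp), if_pos ⟨rfl, rfl⟩,
          ← Nat.sub_add_cancel hl.le, pow_add, Nat.add_sub_cancel]
        ring
      · intro i hi; simp [Ne.symm hi]
    · rw [mul_zero, mul_zero, finsum_mem_of_eqOn_zero]
      intro i hi
      have : l + 1 ≤ i := hi
      have : ¬ (m = i ∧ n = j) := by omega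
      simp [this]

variable {k₀} in
theorem shift_eq_self_iff (hk₀ : k₀ ≠ 0) (a : Weyl K) : shift p k₀ a = a ↔
    ∀ j l : ℕ, (∑ᶠ i ∈ Set.Ici (l + 1), (i.choose l : K) * coeff a (i, j) * k₀ ^ i) = 0 := by
  simp only [← pow_mul_coeff_shift_sub p, mul_eq_zero, pow_ne_zero _ hk₀, false_or]
  rw [← sub_eq_zero]
  refine ⟨fun h j l => by rw [h]; simp, fun h => ext_coeff fun i j => by rw [h]; simp⟩

end shift

/-! ### Invariance in terms of coefficients -/

section criterion

variable {K : Type*} [Field K] (p : ℕ) [CharP K p] (k₀ : K)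

/-- A derivation commutes with `shift` if and only if its values at `x` and `y` are fixed by `shift`;
these in turn split into their components along `E_x`, `E_y` and the inner part. -/
theorem stdDer_comm_shift_iff [Fact p.Prime] {u v : Weyl K} (hu : u ∈ polyP K p)
    (hv : v ∈ polyP K p) (q : Weyl K) :
    (∀ a, stdDer p u v q (shift p k₀ a) = shift p k₀ (stdDer p u v q a)) ↔
      shift p k₀ v = v ∧ shift p k₀ u = u ∧ shift p k₀ (ad (Y K) q) = ad (Y K) q ∧
        shift p k₀ (u * Y K ^ (p - 1) - ad (X K) q) = u * Y K ^ (p - 1) - ad (X K) q := by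
  have hD := stdDer_mem_Der p hu hv q
  have hvX : shift p k₀ v = v → shift p k₀ (v * X K ^ (p - 1)) = v * X K ^ (p - 1) := fun h => by
    rw [map_mul, map_pow, h, shift_X]
  constructor
  · intro h
    have hX := (h (X K)).symm
    have hY := (h (Y K)).symm
    rw [shift_X, stdDer_X] at hX
    rw [shift_Y, map_add, der_algebraMap hD, add_zero, stdDer_Y] at hY
    have hXY : ad (X K) (Y K) = algebraMap K _ 1 := by rw [ad_X_Y, map_one]
    have hYX : ad (Y K) (X K) = algebraMap K _ (-1) := by rw [ad_Y_X, map_neg, map_one]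
    have h1 := shift_eq_of_shift_mul_pow_sub_ad p k₀ (polyP_comm p hv)
      (neg_ne_zero.mpr one_ne_zero) hYX (ad_Y_pow_char p) (shift_ad_Y p k₀) hY
    refine ⟨h1, shift_eq_of_shift_mul_pow_sub_ad p k₀ (polyP_comm p hu) one_ne_zero hXY
      (ad_X_pow_char p) (shift_ad_X p k₀) hX, ?_, hX⟩
    rwa [map_sub, hvX h1, sub_right_inj] at hY
  · rintro ⟨h1, -, h3, h4⟩
    refine der_comp_comm hD _ ?_ ?_
    · rw [shift_X, stdDer_X, h4]
    · rw [shift_Y, map_add, der_algebraMap hD, add_zero, stdDer_Y, map_sub, hvX h1, h3]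

/-- The binomial formula for `∂q/∂y`, with `(l + 1) C(i, l + 1) = i C(i - 1, l)` absorbing the
factor `i` of the derivative. -/
theorem pow_mul_coeff_shift_ad_X_sub (q : Weyl K) (l j : ℕ) :
    k₀ ^ (l + 1) * coeff (shift p k₀ (ad (X K) q) - ad (X K) q) (l, j) =
      ∑ᶠ i ∈ Set.Ici (l + 1 + 1),
        (i.choose (l + 1) : K) * ((l + 1 : ℕ) : K) * coeff q (i, j) * k₀ ^ i := by
  rw [pow_succ', mul_assoc, pow_mul_coeff_shift_sub, mul_finsum_mem]
  refine finsum_mem_eq_of_bijOn (· + 1) ?_ fun i _ => ?_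
  · refine ⟨fun i hi => ?_, fun i _ i' _ h => Nat.succ_injective h, fun i hi => ?_⟩
    · simp only [Set.mem_Ici] at *; omega
    · simp only [Set.mem_Ici] at hi
      exact ⟨i - 1, by simp only [Set.mem_Ici]; omega, by simp only; omega⟩
  · have h := congrArg (Nat.cast (R := K)) (Nat.add_one_mul_choose_eq i l)
    push_cast at h ⊢
    rw [coeff_ad_X, pow_succ]
    linear_combination (coeff q (i + 1, j) * k₀ ^ i * k₀) * h

theorem pow_mul_coeff_mul_shift_Y_pow_sub [Fact p.Prime] {u : Weyl K} (hu : u ∈ polyP K p)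
    (l j : ℕ) :
    k₀ ^ (l + 1) * coeff (u * (shift p k₀ (Y K ^ (p - 1)) - Y K ^ (p - 1))) (l, j) =
      ∑ i ∈ Finset.range (l + 1) with l + 1 + 1 ≤ i + p,
        ((p - 1).choose (l + 1 - 1 - i) : K) * coeff u (i, j) * k₀ ^ (i + p) := by
  have hp := (Fact.out : p.Prime).pos
  have hbin : u * (shift p k₀ (Y K ^ (p - 1)) - Y K ^ (p - 1)) =
      ∑ n ∈ Finset.range (p - 1), (k₀ ^ (p - 1 - n) * (p - 1).choose n) • (Y K ^ n * u) := by
    rw [map_pow, shift_Y, (Algebra.commute_algebraMap_right k₀ (Y K)).add_pow,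
      Finset.sum_range_succ, Nat.sub_self, Nat.choose_self, pow_zero, Nat.cast_one, mul_one,
      mul_one, add_sub_cancel_right, Finset.mul_sum]
    refine Finset.sum_congr rfl fun n _ => ?_
    rw [← map_pow, ← map_natCast (algebraMap K (Weyl K)), polyP_comm p hu]
    simp only [Algebra.algebraMap_eq_smul_one, mul_smul_comm, mul_one, smul_smul, mul_comm]
  rw [hbin, map_sum, Finsupp.finsetSum_apply, Finset.mul_sum]
  simp only [map_smul, Finsupp.smul_apply, coeff_Y_pow_mul, smul_eq_mul, mul_ite, mul_zero]
  rw [← Finset.sum_filter]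
  -- reindex by the exponent `i = l - n` of `y` that `y ^ n` raises to `l`
  refine Finset.sum_nbij' (l - ·) (l - ·) ?_ ?_ ?_ ?_ ?_
  · intro n hn
    simp only [Finset.mem_filter, Finset.mem_range] at *
    omega
  · intro n hn
    simp only [Finset.mem_filter, Finset.mem_range] at *
    omega
  · intro n hn
    simp only [Finset.mem_filter, Finset.mem_range] at *
    omega
  · intro n hn
    simp only [Finset.mem_filter, Finset.mem_range] at *
    omega
  · intro n hn
    simp only [Finset.mem_filter, Finset.mem_range] at hn
    have h1 : l + 1 - 1 - (l - n) = n := by omega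
    have h2 : l - n + p = l + 1 + (p - 1 - n) := by omega
    rw [h1, h2, pow_add]
    ring

variable {k₀}

theorem shift_ad_Y_eq_self_iff (hk₀ : k₀ ≠ 0) (q : Weyl K) :
    shift p k₀ (ad (Y K) q) = ad (Y K) q ↔ ∀ j l : ℕ,
      (∑ᶠ i ∈ Set.Ici (l + 1), (i.choose l : K) * (j : K) * coeff q (i, j) * k₀ ^ i) = 0 := by
  have key : ∀ j l : ℕ,
      (∑ᶠ i ∈ Set.Ici (l + 1), (i.choose l : K) * coeff (ad (Y K) q) (i, j) * k₀ ^ i) =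
      -∑ᶠ i ∈ Set.Ici (l + 1),
        (i.choose l : K) * ((j + 1 : ℕ) : K) * coeff q (i, j + 1) * k₀ ^ i := by
    intro j l
    rw [← neg_one_mul, mul_finsum_mem]
    refine finsum_mem_congr rfl fun i _ => ?_
    rw [coeff_ad_Y]
    push_cast
    ring
  rw [shift_eq_self_iff p hk₀]
  simp only [key, neg_eq_zero]
  refine ⟨fun h j l => ?_, fun h j l => h (j + 1) l⟩
  cases j with
  | zero => simp
  | succ j => exact h j l

/-- For `u` fixed by `shift`, invariance of `D x` means that `shift` moves `∂q/∂y` by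
`u ((y + k₀) ^ (p - 1) - y ^ (p - 1))`; coefficients at `y^(m - 1) x^j` are compared after
multiplication by `k₀ ^ m`. -/
theorem shift_mul_Y_pow_sub_ad_X_eq_self_iff [Fact p.Prime] (hk₀ : k₀ ≠ 0) {u : Weyl K}
    (hu : u ∈ polyP K p) (hus : shift p k₀ u = u) (q : Weyl K) :
    shift p k₀ (u * Y K ^ (p - 1) - ad (X K) q) = u * Y K ^ (p - 1) - ad (X K) q ↔
      ∀ j m : ℕ, 0 < m →
        (∑ᶠ i ∈ Set.Ici (m + 1), (i.choose m : K) * (m : K) * coeff q (i, j) * k₀ ^ i) =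
          ∑ i ∈ Finset.range m with m + 1 ≤ i + p,
            ((p - 1).choose (m - 1 - i) : K) * coeff u (i, j) * k₀ ^ (i + p) := by
  have h1 : shift p k₀ (u * Y K ^ (p - 1) - ad (X K) q) = u * Y K ^ (p - 1) - ad (X K) q ↔
      shift p k₀ (ad (X K) q) - ad (X K) q =
        u * (shift p k₀ (Y K ^ (p - 1)) - Y K ^ (p - 1)) := by
    rw [map_sub, map_mul, hus, mul_sub, sub_eq_sub_iff_sub_eq_sub, eq_comm]
  rw [h1]
  constructor
  · intro h j m hm
    obtain ⟨l, rfl⟩ := Nat.exists_eq_add_one.mpr hm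
    rw [← pow_mul_coeff_shift_ad_X_sub, ← pow_mul_coeff_mul_shift_Y_pow_sub p k₀ hu, h]
  · intro h
    refine ext_coeff fun l j => ?_
    have := h j (l + 1) l.succ_pos
    rw [← pow_mul_coeff_shift_ad_X_sub p, ← pow_mul_coeff_mul_shift_Y_pow_sub p k₀ hu] at this
    exact mul_left_cancel₀ (pow_ne_zero _ hk₀) this

end criterion
end Weyl

end HomWeyl

end

theorem mainTheorem4 {K : Type*} [Field K] (p : ℕ) [Fact p.Prime] [CharP K p]
    (k₀ : K) (hk₀ : k₀ ≠ 0)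
    (δ : HomWeyl.HomWeylAlgebra p (Finsupp.single 0 k₀) →ₗ[K]
      HomWeyl.HomWeylAlgebra p (Finsupp.single 0 k₀)) :
    δ ∈ HomWeyl.Der K (HomWeyl.HomWeylAlgebra p (Finsupp.single 0 k₀)) ↔
      ∃ u v q : ℕ × ℕ →₀ K,
        HomWeyl.Weyl.ofCoeff u ∈ HomWeyl.Weyl.polyP K p ∧
        HomWeyl.Weyl.ofCoeff v ∈ HomWeyl.Weyl.polyP K p ∧
        (∀ a : HomWeyl.Weyl K,
          δ (HomWeyl.YauTwist.of _ a) = HomWeyl.YauTwist.of _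
            (HomWeyl.Weyl.ofCoeff u * HomWeyl.Weyl.Ex K p a +
              HomWeyl.Weyl.ofCoeff v * HomWeyl.Weyl.Ey K p a +
              HomWeyl.Weyl.ad (HomWeyl.Weyl.ofCoeff q) a)) ∧
        (∀ j l : ℕ,
          (∑ᶠ i ∈ Set.Ici (l + 1), (i.choose l : K) * v (i, j) * k₀ ^ i) = 0 ∧
          (∑ᶠ i ∈ Set.Ici (l + 1), (i.choose l : K) * u (i, j) * k₀ ^ i) = 0 ∧
          (∑ᶠ i ∈ Set.Ici (l + 1), (i.choose l : K) * (j : K) * q (i, j) * k₀ ^ i) = 0) ∧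
        (∀ j m : ℕ, 0 < m →
          (∑ᶠ i ∈ Set.Ici (m + 1), (i.choose m : K) * (m : K) * q (i, j) * k₀ ^ i) =
            ∑ i ∈ Finset.range m with m + 1 ≤ i + p,
              ((p - 1).choose (m - 1 - i) : K) * u (i, j) * k₀ ^ (i + p)) := by
  -- the same map, seen on `A₁` itself
  let d : HomWeyl.Weyl K →ₗ[K] HomWeyl.Weyl K :=
    (HomWeyl.YauTwist.of _).symm.toLinearMap ∘ₗ δ ∘ₗ (HomWeyl.YauTwist.of _).toLinearMap
  have hd : δ ∈ HomWeyl.Der K (HomWeyl.HomWeylAlgebra p (Finsupp.single 0 k₀)) ↔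
      ∀ a b, d (HomWeyl.Weyl.shift p k₀ (a * b)) =
        HomWeyl.Weyl.shift p k₀ (d a * b + a * d b) := by
    simp only [map_add]
    exact Iff.rfl
  rw [hd, HomWeyl.Weyl.twisted_der_iff]
  have crit : ∀ u v q : ℕ × ℕ →₀ K, HomWeyl.Weyl.ofCoeff u ∈ HomWeyl.Weyl.polyP K p →
      HomWeyl.Weyl.ofCoeff v ∈ HomWeyl.Weyl.polyP K p →
      ((∀ a, HomWeyl.Weyl.stdDer p (HomWeyl.Weyl.ofCoeff u) (HomWeyl.Weyl.ofCoeff v)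
          (HomWeyl.Weyl.ofCoeff q) (HomWeyl.Weyl.shift p k₀ a) = HomWeyl.Weyl.shift p k₀
        (HomWeyl.Weyl.stdDer p (HomWeyl.Weyl.ofCoeff u) (HomWeyl.Weyl.ofCoeff v)
          (HomWeyl.Weyl.ofCoeff q) a)) ↔
        (∀ j l : ℕ,
          (∑ᶠ i ∈ Set.Ici (l + 1), (i.choose l : K) * v (i, j) * k₀ ^ i) = 0 ∧
          (∑ᶠ i ∈ Set.Ici (l + 1), (i.choose l : K) * u (i, j) * k₀ ^ i) = 0 ∧
          (∑ᶠ i ∈ Set.Ici (l + 1), (i.choose l : K) * (j : K) * q (i, j) * k₀ ^ i) = 0) ∧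
        (∀ j m : ℕ, 0 < m →
          (∑ᶠ i ∈ Set.Ici (m + 1), (i.choose m : K) * (m : K) * q (i, j) * k₀ ^ i) =
            ∑ i ∈ Finset.range m with m + 1 ≤ i + p,
              ((p - 1).choose (m - 1 - i) : K) * u (i, j) * k₀ ^ (i + p))) := by
    intro u v q hu hv
    have hsu := HomWeyl.Weyl.shift_eq_self_iff p hk₀ (HomWeyl.Weyl.ofCoeff u)
    have hsv := HomWeyl.Weyl.shift_eq_self_iff p hk₀ (HomWeyl.Weyl.ofCoeff v)
    have hsq := HomWeyl.Weyl.shift_ad_Y_eq_self_iff p hk₀ (HomWeyl.Weyl.ofCoeff q)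
    have hsX := fun h => HomWeyl.Weyl.shift_mul_Y_pow_sub_ad_X_eq_self_iff p hk₀ hu h
      (HomWeyl.Weyl.ofCoeff q)
    simp only [HomWeyl.Weyl.coeff_ofCoeff] at hsu hsv hsq hsX
    rw [HomWeyl.Weyl.stdDer_comm_shift_iff p k₀ hu hv]
    simp only [forall_and]
    rw [hsv, hsq, ← hsu]
    constructor
    · rintro ⟨h1, h2, h3, h4⟩
      exact ⟨⟨h1, h2, h3⟩, (hsX h2).mp h4⟩
    · rintro ⟨⟨h1, h2, h3⟩, h4⟩
      exact ⟨h1, h2, h3, (hsX h2).mpr h4⟩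
  constructor
  · rintro ⟨hD, hcomm⟩
    obtain ⟨u, v, q, hu, hv, hduvq⟩ := HomWeyl.Weyl.exists_stdDer_eq p hD
    rw [hduvq] at hcomm
    exact ⟨u, v, q, hu, hv, DFunLike.congr_fun hduvq, (crit u v q hu hv).mp hcomm⟩
  · rintro ⟨u, v, q, hu, hv, hduvq, hcond⟩
    have h : d = HomWeyl.Weyl.stdDer p (HomWeyl.Weyl.ofCoeff u) (HomWeyl.Weyl.ofCoeff v)
        (HomWeyl.Weyl.ofCoeff q) := LinearMap.ext hduvq
    rw [h]
    exact ⟨HomWeyl.Weyl.stdDer_mem_Der p hu hv _, (crit u v q hu hv).mpr hcond⟩
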